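/- Let $\mathcal M_n(\mathbb C)$ be the $n\times n$ complex matrices and let $\Pi^d$ be the set of all $d$-tuples $Z=(Z_1,\dots,Z_d)$ of square matrices of a common size $n\ge 1$ such that $\operatorname{Im} Z_i=\frac1{2i}(Z_i-Z_i^*)$ is strictly positive definite for every $i$. A free Pick function is a function $h$ on $\Pi^d$ that sends $d$-tuples of $n\times n$ matrices to $n\times n$ matrices, respects direct sums ($h(X\oplus Y)=h(X)\oplus h(Y)$), respects similarity ($h(S^{-1}XS)=S^{-1}h(X)S$ whenever $S$ is invertible and $X,S^{-1}XS\in\Pi^d$), and takes values in $\overline{\Pi^1}$ (the closure being taken at each matrix size). Let $\mathcal H$ be a complex Hilbert space, $A$ a closed densely defined self-adjoint operator on $\mathcal H$ with domain $\mathcal D(A)$, and $Y=(Y_1,\dots,Y_d)$ a positive decomposition of $\mathcal H$, i.e. positive bounded operators with $\sum_i Y_i=I$. For $Z\in\Pi^d$ of size $n$ put $\delta_Y(Z)=\sum_i Y_i\otimes Z_i$ and define the following operators on $\mathcal H\otimes\mathbb C^n$, which are everywhere defined and bounded: $$M_2(Z)=(A\otimes I-\delta_Y(Z))^{-1},$$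 $$M_3(Z)=\big((I-iA)\otimes I\big)\,\big(A\otimes I-\delta_Y(Z)\big)^{-1}\,\big(I+\delta_Y(Z)(A\otimes I)\big)\,\big((I-iA)^{-1}\otimes I\big).$$ For $k\in\{2,3\}$, a type $k$ (Nevanlinna) representation of $h$ consists of such $\mathcal H$, $A$, $Y$ together with $a\in\mathbb R$ and a vector $v\in\mathcal H$ such that $$h(Z)=a\,I+(v^*\otimes I)\,M_k(Z)\,(v\otimes I)\qquad\text{for all } Z\in\Pi^d .$$ Proposition. Let $h$ be a free Pick function. If $h$ has a type 2 representation, then $h$ has a type 3 representation. Conversely, if $h$ has a type 3 representation whose vector satisfies $v\in\mathcal D(A)$, then $h$ has a type 2 representation. -/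

import Mathlib

universe u

namespace FreePick

open scoped Matrix InnerProductSpace ComplexOrder

noncomputable section

/-! ### Free functions and the free Pick class -/

/-- The block diagonal matrix `X ⊕ Y`, indexed by `Fin (m + n)`. -/
def directSum {m n : ℕ} (X : Matrix (Fin m) (Fin m) ℂ) (Y : Matrix (Fin n) (Fin n) ℂ) :
    Matrix (Fin (m + n)) (Fin (m + n)) ℂ :=
  Matrix.reindex finSumFinEquiv finSumFinEquiv (Matrix.fromBlocks X 0 0 Y)

/-- A graded function on (a part of) the `d`-dimensional matrix universe: it sends a `d`-tuple of
`n × n` matrices to an `n × n` matrix. Only its values on the domain under consideration matter.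
(There is one tuple of size `n = 0`; it satisfies every condition below vacuously.) -/
abbrev GradedFun (d : ℕ) : Type :=
  ∀ n : ℕ, (Fin d → Matrix (Fin n) (Fin n) ℂ) → Matrix (Fin n) (Fin n) ℂ

/-- `f` is a free function on the domain `D`: it is graded (by its type), respects direct sums and
respects similarities. -/
structure IsFreeFunction {d : ℕ} (D : ∀ n : ℕ, Set (Fin d → Matrix (Fin n) (Fin n) ℂ))
    (f : GradedFun d) : Prop where
  map_directSum : ∀ (m n : ℕ), ∀ X ∈ D m, ∀ Y ∈ D n,
    f (m + n) (fun i => directSum (X i) (Y i)) = directSum (f m X) (f n Y)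
  map_similarity : ∀ (n : ℕ) (S : (Matrix (Fin n) (Fin n) ℂ)ˣ), ∀ X ∈ D n,
    (fun i => S⁻¹.val * X i * S.val) ∈ D n →
      f n (fun i => S⁻¹.val * X i * S.val) = S⁻¹.val * f n X * S.val

/-- The imaginary part `(W - W*) / (2i)` of a square matrix. -/
def imPart {n : ℕ} (W : Matrix (Fin n) (Fin n) ℂ) : Matrix (Fin n) (Fin n) ℂ :=
  (1 / (2 * Complex.I)) • (W - Wᴴ)

/-- The matrices of size `n` with strictly positive definite imaginary part: level `n` of `Π¹`. -/
def upperHalf (n : ℕ) : Set (Matrix (Fin n) (Fin n) ℂ) := {W | (imPart W).PosDef}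

/-- Level `n` of the free polyupperhalfplane `Πᵈ`. -/
def polyUpperHalf (d n : ℕ) : Set (Fin d → Matrix (Fin n) (Fin n) ℂ) :=
  {X | ∀ i, X i ∈ upperHalf n}

/-- The free Pick class: free functions on `Πᵈ` with values in the closure of `Π¹`. -/
structure IsFreePick {d : ℕ} (h : GradedFun d) : Prop where
  isFree : IsFreeFunction (polyUpperHalf d) h
  mem_closure : ∀ (n : ℕ), ∀ X ∈ polyUpperHalf d n, h n X ∈ closure (upperHalf n)

/-! ### Operators on `ℋ ⊗ ℂⁿ`, realized as the orthogonal sum of `n` copies of `ℋ` -/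

section Operators

variable {H : Type*} [NormedAddCommGroup H] [InnerProductSpace ℂ H]

/-- The Hilbert space `ℋ ⊗ ℂⁿ`, identified with the orthogonal sum of `n` copies of `ℋ`: the
simple tensor `x ⊗ c` is the family `(c j • x)_j`. -/
abbrev Ampl (H : Type*) [NormedAddCommGroup H] [InnerProductSpace ℂ H] (n : ℕ) : Type _ :=
  PiLp 2 (fun _ : Fin n => H)

/-- `v ⊗ I : ℂⁿ → ℋ ⊗ ℂⁿ`, `c ↦ v ⊗ c`. Its adjoint is `v* ⊗ I`. -/
def ket (v : H) (n : ℕ) : EuclideanSpace ℂ (Fin n) →L[ℂ] Ampl H n :=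
  ((PiLp.continuousLinearEquiv 2 ℂ (fun _ : Fin n => H)).symm :
      (Fin n → H) →L[ℂ] Ampl H n) ∘L
    ContinuousLinearMap.pi (fun j =>
      (EuclideanSpace.proj j : EuclideanSpace ℂ (Fin n) →L[ℂ] ℂ).smulRight v)

/-- `S ⊗ M` for a bounded operator `S` on `ℋ` and an `n × n` matrix `M`. -/
def kron {n : ℕ} (S : H →L[ℂ] H) (M : Matrix (Fin n) (Fin n) ℂ) : Ampl H n →L[ℂ] Ampl H n :=
  ((PiLp.continuousLinearEquiv 2 ℂ (fun _ : Fin n => H)).symm :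
      (Fin n → H) →L[ℂ] Ampl H n) ∘L
    ContinuousLinearMap.pi (fun j =>
      ∑ k, M j k • (S ∘L (PiLp.proj 2 (fun _ : Fin n => H) k : Ampl H n →L[ℂ] H)))

/-- `T ⊗ I` for a partially defined operator `T` on `ℋ`, with domain `𝒟(T) ⊗ ℂⁿ`. -/
def ampl (T : H →ₗ.[ℂ] H) (n : ℕ) : Ampl H n →ₗ.[ℂ] Ampl H n where
  domain :=
    { carrier := {x | ∀ j, x j ∈ T.domain}
      add_mem' := fun hx hy j => T.domain.add_mem (hx j) (hy j)
      zero_mem' := fun _ => T.domain.zero_mem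
      smul_mem' := fun c _ hx j => T.domain.smul_mem c (hx j) }
  toFun :=
    { toFun := fun x => WithLp.toLp 2 (fun j => T ⟨x.1 j, x.2 j⟩)
      map_add' := fun x y => by
        ext j
        exact T.map_add ⟨x.1 j, x.2 j⟩ ⟨y.1 j, y.2 j⟩
      map_smul' := fun c x => by
        ext j
        exact T.map_smul c ⟨x.1 j, x.2 j⟩ }

/-- A bounded operator, regarded as an operator with domain the whole space. -/
def total {E : Type*} [NormedAddCommGroup E] [InnerProductSpace ℂ E] (M : E →L[ℂ] E) :
    E →ₗ.[ℂ] E :=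
  (M : E →ₗ[ℂ] E).toPMap ⊤

/-- The product `S T` of partially defined operators, with its maximal domain
`{x ∈ 𝒟(T) | T x ∈ 𝒟(S)}`. -/
def mulOp {E : Type*} [NormedAddCommGroup E] [InnerProductSpace ℂ E] (S T : E →ₗ.[ℂ] E) :
    E →ₗ.[ℂ] E :=
  S.comp (T.domRestrict ((S.domain.comap T.toFun).map T.domain.subtype)) (by
    rintro ⟨x, hx, hx'⟩
    obtain ⟨y, hy, rfl⟩ := hx
    exact hy)

/-- The bounded operator given by an everywhere defined bounded operator (and `0` otherwise). -/
def toBounded {E : Type*} [NormedAddCommGroup E] [InnerProductSpace ℂ E] (T : E →ₗ.[ℂ] E) :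
    E →L[ℂ] E :=
  open scoped Classical in
  if h : ∃ M : E →L[ℂ] E, T = total M then h.choose else 0

/-- A positive decomposition of `ℋ`: positive operators `Y₁, …, Y_d` with sum `I`. -/
structure IsPositiveDecomposition {d : ℕ} (Y : Fin d → H →L[ℂ] H) : Prop where
  isPositive : ∀ i, (Y i).IsPositive
  sum_eq_one : ∑ i, Y i = 1

/-- `δ_Y(Z) = ∑ i, Y i ⊗ Z i`. -/
def delta {d n : ℕ} (Y : Fin d → H →L[ℂ] H) (Z : Fin d → Matrix (Fin n) (Fin n) ℂ) :
    Ampl H n →L[ℂ] Ampl H n :=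
  ∑ i, kron (Y i) (Z i)

/-! ### Structured resolvents -/

/-- `(A ⊗ I - δ_Y(Z))⁻¹` as a partially defined operator. -/
def resolventOp {d n : ℕ} (A : H →ₗ.[ℂ] H) (Y : Fin d → H →L[ℂ] H)
    (Z : Fin d → Matrix (Fin n) (Fin n) ℂ) : Ampl H n →ₗ.[ℂ] Ampl H n :=
  (ampl A n - total (delta Y Z)).inverse

/-- `I - iA`, with domain `𝒟(A)`. -/
def oneSubI (A : H →ₗ.[ℂ] H) : H →ₗ.[ℂ] H := total 1 - Complex.I • A

/-- `((I - iA) ⊗ I) (A ⊗ I - δ_Y(Z))⁻¹ (I + δ_Y(Z) (A ⊗ I)) ((I - iA)⁻¹ ⊗ I)` as a partially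
defined operator. -/
def resolventOp₃ {d n : ℕ} (A : H →ₗ.[ℂ] H) (Y : Fin d → H →L[ℂ] H)
    (Z : Fin d → Matrix (Fin n) (Fin n) ℂ) : Ampl H n →ₗ.[ℂ] Ampl H n :=
  mulOp (ampl (oneSubI A) n)
    (mulOp (resolventOp A Y Z)
      (mulOp (total 1 + mulOp (total (delta Y Z)) (ampl A n))
        (ampl (oneSubI A).inverse n)))

/-- The structured resolvent of type 2, `M₂(Z) = (A ⊗ I - δ_Y(Z))⁻¹`, a bounded operator for `Z`
in `Πᵈ` (see `type2Resolvent_spec`). -/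
def type2Resolvent {d n : ℕ} (A : H →ₗ.[ℂ] H) (Y : Fin d → H →L[ℂ] H)
    (Z : Fin d → Matrix (Fin n) (Fin n) ℂ) : Ampl H n →L[ℂ] Ampl H n :=
  toBounded (resolventOp A Y Z)

/-- The structured resolvent of type 3,
`M₃(Z) = ((I - iA) ⊗ I) (A ⊗ I - δ_Y(Z))⁻¹ (I + δ_Y(Z) (A ⊗ I)) ((I - iA)⁻¹ ⊗ I)`,
a bounded operator for `Z` in `Πᵈ` (see `type3Resolvent_spec`). -/
def type3Resolvent {d n : ℕ} (A : H →ₗ.[ℂ] H) (Y : Fin d → H →L[ℂ] H)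
    (Z : Fin d → Matrix (Fin n) (Fin n) ℂ) : Ampl H n →L[ℂ] Ampl H n :=
  toBounded (resolventOp₃ A Y Z)

/-! ### The structured resolvents are bounded operators -/

theorem total_apply {E : Type*} [NormedAddCommGroup E] [InnerProductSpace ℂ E] (M : E →L[ℂ] E)
    (x : (total M).domain) : total M x = M x := rfl

theorem toBounded_spec {E : Type*} [NormedAddCommGroup E] [InnerProductSpace ℂ E]
    {T : E →ₗ.[ℂ] E} (h : ∃ M : E →L[ℂ] E, T = total M) : T = total (toBounded T) := by
  unfold toBounded
  rw [dif_pos h]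
  exact h.choose_spec

theorem eq_total_iff {E : Type*} [NormedAddCommGroup E] [InnerProductSpace ℂ E]
    {T : E →ₗ.[ℂ] E} {M : E →L[ℂ] E} (h : ∀ x, (x, M x) ∈ T.graph) : T = total M := by
  refine (LinearPMap.eq_of_le_of_domain_eq (f := total M) (g := T)
    (LinearPMap.le_of_le_graph ?_) ?_).symm
  · rintro ⟨x, y⟩ hxy
    obtain ⟨z, hz, hz'⟩ := (LinearPMap.mem_graph_iff _).1 hxy
    simp only at hz hz'
    rw [← hz', total_apply, hz]
    exact h x
  · ext x
    exact ⟨fun _ => LinearPMap.mem_domain_of_mem_graph (h x), fun _ => Submodule.mem_top⟩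

theorem mem_graph_mulOp {E : Type*} [NormedAddCommGroup E] [InnerProductSpace ℂ E]
    {S T : E →ₗ.[ℂ] E} {x y z : E} (h₁ : (x, y) ∈ T.graph) (h₂ : (y, z) ∈ S.graph) :
    (x, z) ∈ (mulOp S T).graph := by
  obtain ⟨x', hx, hy⟩ := (LinearPMap.mem_graph_iff _).1 h₁
  obtain ⟨y', hy', hz⟩ := (LinearPMap.mem_graph_iff _).1 h₂
  simp only at hx hy hy' hz
  subst hx
  have hm : T x' ∈ S.domain := by rw [hy, ← hy']; exact y'.2
  refine (LinearPMap.mem_graph_iff _).2 ⟨⟨x', ⟨x', hm, rfl⟩, x'.2⟩, rfl, ?_⟩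
  rw [← hz]
  change S ⟨T x', hm⟩ = S y'
  congr 1
  exact Subtype.ext (hy.trans hy'.symm)

theorem mem_graph_total {E : Type*} [NormedAddCommGroup E] [InnerProductSpace ℂ E]
    (M : E →L[ℂ] E) (x : E) : (x, M x) ∈ (total M).graph :=
  (total M).mem_graph ⟨x, Submodule.mem_top⟩

theorem mem_graph_ampl {T : H →ₗ.[ℂ] H} {n : ℕ} {x y : Ampl H n} :
    (x, y) ∈ (ampl T n).graph ↔ ∀ j, (x j, y j) ∈ T.graph := by
  constructor
  · intro h j
    obtain ⟨x', hx, hy⟩ := (LinearPMap.mem_graph_iff _).1 h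
    simp only at hx hy
    subst hx hy
    exact T.mem_graph ⟨x'.1 j, x'.2 j⟩
  · intro h
    refine (LinearPMap.mem_graph_iff _).2
      ⟨⟨x, fun j => LinearPMap.mem_domain_of_mem_graph (h j)⟩, rfl, ?_⟩
    ext j
    exact ((LinearPMap.image_iff _).2 (h j)).symm

theorem isSelfAdjoint_ampl [CompleteSpace H] {A : H →ₗ.[ℂ] H} (hA : IsSelfAdjoint A) (n : ℕ) :
    IsSelfAdjoint (ampl A n) := by
  have hd := hA.dense_domain
  have hdn : Dense ((ampl A n).domain : Set (Ampl H n)) := by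
    have h1 : Dense (Set.pi Set.univ (fun _ : Fin n => (A.domain : Set H))) :=
      dense_pi _ (fun _ _ => hd)
    have h2 := h1.preimage
      (PiLp.homeomorph 2 (fun _ : Fin n => H)).isOpenMap
    refine h2.mono ?_
    intro x hx j
    exact hx j (Set.mem_univ j)
  rw [LinearPMap.isSelfAdjoint_def]
  have hformal := LinearPMap.adjoint_isFormalAdjoint hd
  rw [LinearPMap.isSelfAdjoint_def.1 hA] at hformal
  have hf : (ampl A n).IsFormalAdjoint (ampl A n) := by
    intro x y
    rw [PiLp.inner_apply, PiLp.inner_apply]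
    exact Finset.sum_congr rfl fun j _ => hformal ⟨x.1 j, x.2 j⟩ ⟨y.1 j, y.2 j⟩
  refine (LinearPMap.eq_of_le_of_domain_eq (hf.le_adjoint hdn) (le_antisymm
    (hf.le_adjoint hdn).1 ?_)).symm
  intro y hy j
  rw [← LinearPMap.isSelfAdjoint_def.1 hA]
  refine LinearPMap.mem_adjoint_domain_of_exists _ ⟨(ampl A n).adjoint ⟨y, hy⟩ j, fun x => ?_⟩
  classical
  have hx : WithLp.toLp 2 (Pi.single j (x : H)) ∈ (ampl A n).domain := by
    intro k
    by_cases hk : k = j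
    · subst hk; simp
    · simp [hk]
  have h := LinearPMap.adjoint_isFormalAdjoint hdn ⟨y, hy⟩ ⟨_, hx⟩
  rw [PiLp.inner_apply, PiLp.inner_apply] at h
  rw [Finset.sum_eq_single j, Finset.sum_eq_single j] at h
  · simp only [Pi.single_eq_same] at h
    rw [h]
    congr 1
    change A ⟨_, hx j⟩ = A x
    congr 1
    exact Subtype.ext (by simp)
  · intro k _ hk
    have : A ⟨_, hx k⟩ = 0 := by
      rw [← A.map_zero]
      congr 1
      exact Subtype.ext (by simp [hk])
    change inner ℂ (y k) (A ⟨_, hx k⟩) = 0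
    rw [this, inner_zero_right]
  · simp
  · intro k _ hk
    simp [hk]
  · simp

/-- If `T` is self-adjoint and `|Im ⟪x, B x⟫| ≥ ε ‖x‖²`, then `T - B` has an everywhere defined
bounded inverse. -/
theorem exists_inverse {E : Type*} [NormedAddCommGroup E] [InnerProductSpace ℂ E] [CompleteSpace E]
    {T : E →ₗ.[ℂ] E} (hT : IsSelfAdjoint T) (B : E →L[ℂ] E) {ε : ℝ} (hε : 0 < ε)
    (hB : ∀ x, ε * ‖x‖ ^ 2 ≤ |(inner ℂ x (B x)).im|) :
    (T - total B).toFun.ker = ⊥ ∧ ∃ S : E →L[ℂ] E, (T - total B).inverse = total S ∧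
      ∀ y, (S y, y + B (S y)) ∈ T.graph := by
  have hformal := LinearPMap.adjoint_isFormalAdjoint hT.dense_domain
  rw [LinearPMap.isSelfAdjoint_def.1 hT] at hformal
  have hreal : ∀ x : T.domain, (inner ℂ (x : E) (T x)).im = 0 := by
    intro x
    have h := hformal x x
    rw [← inner_conj_symm] at h
    exact Complex.conj_eq_iff_im.1 h
  have hlow : ∀ x : T.domain, ε * ‖(x : E)‖ ≤ ‖T x - B x‖ := by
    intro x
    have h1 : (inner ℂ (x : E) (T x - B x)).im = -(inner ℂ (x : E) (B x)).im := by
      rw [inner_sub_right, Complex.sub_im, hreal, zero_sub]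
    have h2 : ε * ‖(x : E)‖ ^ 2 ≤ ‖(x : E)‖ * ‖T x - B x‖ := by
      refine (hB x).trans ?_
      rw [← abs_neg, ← h1]
      exact (Complex.abs_im_le_norm _).trans (norm_inner_le_norm _ _)
    by_cases h0 : ‖(x : E)‖ = 0
    · rw [h0, mul_zero]; exact norm_nonneg _
    · have hpos : 0 < ‖(x : E)‖ := lt_of_le_of_ne (norm_nonneg _) (Ne.symm h0)
      refine le_of_mul_le_mul_left ?_ hpos
      linarith [h2, sq (‖(x : E)‖)]
  have hinj : ∀ x : T.domain, T x - B x = 0 → x = 0 := by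
    intro x hx
    have h := hlow x
    rw [hx, norm_zero] at h
    have : ‖(x : E)‖ ≤ 0 := by
      by_contra hc
      exact absurd h (not_le.2 (mul_pos hε (not_le.1 hc)))
    exact Subtype.ext (norm_le_zero_iff.1 this)
  -- the range is closed and dense
  let L : T.domain →ₗ[ℂ] E := T.toFun - (B : E →ₗ[ℂ] E).comp T.domain.subtype
  have hL : ∀ x, L x = T x - B x := fun x => rfl
  have hclosed : IsClosed (LinearMap.range L : Set E) := by
    refine isClosed_of_closure_subset fun y hy => ?_
    obtain ⟨u, hu, hlim⟩ := mem_closure_iff_seq_limit.1 hy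
    choose w hw using hu
    have hcau : CauchySeq (fun k => (w k : E)) := by
      have hcy := hlim.cauchySeq
      rw [Metric.cauchySeq_iff] at hcy ⊢
      intro δ hδ
      obtain ⟨N, hN⟩ := hcy (ε * δ) (mul_pos hε hδ)
      refine ⟨N, fun p hp q hq => ?_⟩
      have h1 := hN p hp q hq
      rw [dist_eq_norm, ← hw, ← hw, ← map_sub, hL] at h1
      have h2 := (hlow (w p - w q)).trans_lt h1
      rw [dist_eq_norm]
      exact lt_of_mul_lt_mul_left h2 hε.le
    obtain ⟨x, hx⟩ := cauchySeq_tendsto_of_complete hcau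
    have hTx : Filter.Tendsto (fun k => T (w k)) Filter.atTop (nhds (y + B x)) := by
      have h1 : (fun k => T (w k)) = fun k => u k + B (w k) := by
        funext k
        rw [← hw, hL]
        abel
      rw [h1]
      exact hlim.add ((B.continuous.tendsto x).comp hx)
    have hg : (x, y + B x) ∈ T.graph := by
      have hcl : IsClosed (T.graph : Set (E × E)) := hT.isClosed
      exact hcl.mem_of_tendsto (hx.prodMk_nhds hTx)
        (Filter.Eventually.of_forall fun k => T.mem_graph (w k))
    obtain ⟨x', hx', hx''⟩ := (LinearPMap.mem_graph_iff _).1 hg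
    simp only at hx' hx''
    refine ⟨x', ?_⟩
    rw [hL, hx'', hx', add_sub_cancel_right]
  have hsurj : ∀ y, ∃ x, L x = y := by
    have htop : LinearMap.range L = ⊤ := by
      have : CompleteSpace (LinearMap.range L) := hclosed.completeSpace_coe
      rw [← Submodule.orthogonal_eq_bot_iff, Submodule.eq_bot_iff]
      intro y hy
      have hy' : ∀ x : T.domain, inner ℂ (B.adjoint y) (x : E) = inner ℂ y (T x) := by
        intro x
        have h := (Submodule.mem_orthogonal' _ _).1 hy (L x) ⟨x, rfl⟩
        rw [hL, inner_sub_right, sub_eq_zero] at h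
        rw [ContinuousLinearMap.adjoint_inner_left, h]
      have hyd : y ∈ T.adjoint.domain := LinearPMap.mem_adjoint_domain_of_exists _ ⟨_, hy'⟩
      have hyT : T.adjoint ⟨y, hyd⟩ = B.adjoint y :=
        LinearPMap.adjoint_apply_eq hT.dense_domain _ hy'
      have hyd' : y ∈ T.domain := by rwa [LinearPMap.isSelfAdjoint_def.1 hT] at hyd
      have h1 := hy' ⟨y, hyd'⟩
      have h2 := hreal ⟨y, hyd'⟩
      simp only at h1 h2
      rw [← h1, ContinuousLinearMap.adjoint_inner_left] at h2
      have h3 := hB y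
      rw [h2, abs_zero] at h3
      have h4 : ‖y‖ ^ 2 ≤ 0 := by
        by_contra hc
        exact absurd h3 (not_le.2 (mul_pos hε (not_le.1 hc)))
      have h5 : ‖y‖ = 0 := by nlinarith [norm_nonneg y]
      exact norm_eq_zero.1 h5
    intro y
    have : y ∈ LinearMap.range L := htop ▸ Submodule.mem_top
    exact this
  have hker : (T - total B).toFun.ker = ⊥ := by
    rw [LinearMap.ker_eq_bot']
    intro x hx
    have h : T ⟨x.1, x.2.1⟩ - B x.1 = 0 := hx
    have := hinj ⟨x.1, x.2.1⟩ h
    exact Subtype.ext (congrArg (Subtype.val : T.domain → E) this)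
  refine ⟨hker, ?_⟩
  have hLinj : Function.Injective L := by
    rw [← LinearMap.ker_eq_bot, LinearMap.ker_eq_bot']
    exact fun x hx => hinj x hx
  let e : T.domain ≃ₗ[ℂ] E := LinearEquiv.ofBijective L ⟨hLinj, hsurj⟩
  have he : ∀ y, L (e.symm y) = y := fun y => e.apply_symm_apply y
  let S : E →L[ℂ] E := (T.domain.subtype ∘ₗ (e.symm : E →ₗ[ℂ] T.domain)).mkContinuous ε⁻¹ (by
    intro y
    have h := hlow (e.symm y)
    rw [← hL, he] at h
    rw [inv_mul_eq_div, le_div_iff₀ hε, mul_comm]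
    exact h)
  have hS : ∀ y, S y = (e.symm y : E) := fun y => rfl
  refine ⟨S, eq_total_iff fun y => ?_, fun y => ?_⟩
  · have h := LinearPMap.mem_inverse_graph hker
      ⟨(e.symm y : E), (e.symm y).2, Submodule.mem_top⟩
    have h' : (T - total B) ⟨(e.symm y : E), (e.symm y).2, Submodule.mem_top⟩ = y := he y
    rw [h'] at h
    exact h
  · refine (LinearPMap.mem_graph_iff _).2 ⟨e.symm y, hS y, ?_⟩
    have h := he y
    rw [hL] at h
    change T (e.symm y) = y + B (e.symm y : E)
    exact sub_eq_iff_eq_add.1 h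

theorem kron_apply {n : ℕ} (S : H →L[ℂ] H) (M : Matrix (Fin n) (Fin n) ℂ) (x : Ampl H n)
    (j : Fin n) : kron S M x j = ∑ k, M j k • S (x k) := by
  simp [kron]

/-- `(S ⊗ M) (v ⊗ c) = S v ⊗ M c`. -/
theorem kron_ket {n : ℕ} (S : H →L[ℂ] H) (M : Matrix (Fin n) (Fin n) ℂ) (v : H)
    (c : EuclideanSpace ℂ (Fin n)) :
    kron S M (ket v n c) = ket (S v) n (Matrix.toEuclideanCLM (𝕜 := ℂ) M c) := by
  ext j
  simp [kron, ket, Matrix.mulVec, dotProduct, smul_smul, Finset.sum_smul]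

theorem inner_kron {n : ℕ} (S : H →L[ℂ] H) (M : Matrix (Fin n) (Fin n) ℂ) (x : Ampl H n) :
    inner ℂ x (kron S M x) = ∑ j, ∑ k, M j k * inner ℂ (x j) (S (x k)) := by
  rw [PiLp.inner_apply]
  refine Finset.sum_congr rfl fun j _ => ?_
  rw [kron_apply, inner_sum]
  exact Finset.sum_congr rfl fun k _ => by rw [inner_smul_right]

open scoped MatrixOrder Matrix.Norms.L2Operator in
theorem inner_kron_posSemidef {n : ℕ} {S : H →L[ℂ] H} (hS : S.IsPositive)
    {M : Matrix (Fin n) (Fin n) ℂ} (hM : M.PosSemidef) (x : Ampl H n) :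
    0 ≤ (inner ℂ x (kron S M x)).re := by
  obtain ⟨C, rfl⟩ := (CStarAlgebra.nonneg_iff_eq_star_mul_self).1 hM.nonneg
  have h : inner ℂ x (kron S (star C * C) x) =
      ∑ l, inner ℂ (∑ j, C l j • x j) (S (∑ k, C l k • x k)) := by
    rw [inner_kron]
    have h' : ∀ l, inner ℂ (∑ j, C l j • x j) (S (∑ k, C l k • x k)) =
        ∑ j, ∑ k, star (C l j) * C l k * inner ℂ (x j) (S (x k)) := by
      intro l
      rw [sum_inner]
      refine Finset.sum_congr rfl fun j _ => ?_
      rw [map_sum, inner_sum]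
      refine Finset.sum_congr rfl fun k _ => ?_
      rw [map_smul, inner_smul_left, inner_smul_right, mul_assoc]
      rfl
    simp only [h']
    symm
    rw [Finset.sum_comm]
    refine Finset.sum_congr rfl fun j _ => ?_
    rw [Finset.sum_comm]
    refine Finset.sum_congr rfl fun k _ => ?_
    rw [Matrix.mul_apply, Finset.sum_mul]
    rfl
  rw [h, Complex.re_sum]
  exact Finset.sum_nonneg fun l _ => (hS.re_inner_nonneg_right _)

open scoped MatrixOrder in
theorem exists_lower_bound {n : ℕ} {M : Matrix (Fin n) (Fin n) ℂ} (hM : M.PosDef) :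
    ∃ r : ℝ, 0 < r ∧ (M - (r : ℂ) • 1).PosSemidef := by
  rcases Nat.eq_zero_or_pos n with rfl | hn
  · refine ⟨1, one_pos, ?_⟩
    rw [Subsingleton.elim (M - ((1 : ℝ) : ℂ) • 1) 0]
    exact Matrix.PosSemidef.zero
  · have : NeZero n := ⟨hn.ne'⟩
    obtain ⟨r, hr, h⟩ := (CFC.exists_pos_algebraMap_le_iff (a := M) hM.1).2
      fun x hx => hM.isStrictlyPositive.spectrum_pos hx
    refine ⟨r, hr, ?_⟩
    rw [Matrix.le_iff] at h
    have he : (r : ℂ) • (1 : Matrix (Fin n) (Fin n) ℂ) = algebraMap ℝ _ r := by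
      rw [Algebra.algebraMap_eq_smul_one]
      exact Complex.coe_smul r _
    rw [he]
    exact h

/-- `Im ⟪x, (S ⊗ M) x⟫ ≥ r ⟪x, (S ⊗ I) x⟫` if `S ≥ 0` and `Im M ≥ r`. -/
theorem im_inner_kron {n : ℕ} {S : H →L[ℂ] H} (hS : S.IsPositive)
    {M : Matrix (Fin n) (Fin n) ℂ} {r : ℝ} (hM : (imPart M - (r : ℂ) • 1).PosSemidef)
    (x : Ampl H n) :
    r * (∑ j, inner ℂ (x j) (S (x j))).re ≤ (inner ℂ x (kron S M x)).im := by
  have h := inner_kron_posSemidef hS hM x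
  have h1 : inner ℂ x (kron S (imPart M - (r : ℂ) • 1) x) =
      inner ℂ x (kron S (imPart M) x) - r * ∑ j, inner ℂ (x j) (S (x j)) := by
    simp only [inner_kron, Matrix.sub_apply, Matrix.smul_apply, Matrix.one_apply, sub_mul,
      Finset.sum_sub_distrib, Finset.mul_sum]
    simp
  have h2 : inner ℂ x (kron S (imPart M) x) = ((inner ℂ x (kron S M x)).im : ℂ) := by
    have h3 : inner ℂ x (kron S Mᴴ x) = starRingEnd ℂ (inner ℂ x (kron S M x)) := by
      simp only [inner_kron, map_sum, map_mul, Matrix.conjTranspose_apply]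
      rw [Finset.sum_comm]
      refine Finset.sum_congr rfl fun j _ => Finset.sum_congr rfl fun k _ => ?_
      rw [inner_conj_symm, ← ContinuousLinearMap.coe_coe S, hS.isSymmetric]
      rfl
    have h4 : inner ℂ x (kron S (imPart M) x) =
        (1 / (2 * Complex.I)) * (inner ℂ x (kron S M x) - inner ℂ x (kron S Mᴴ x)) := by
      simp only [inner_kron, imPart, Matrix.sub_apply, Matrix.smul_apply, smul_eq_mul, mul_sub,
        sub_mul, Finset.sum_sub_distrib, Finset.mul_sum, mul_assoc]
    rw [h4, h3, Complex.sub_conj]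
    push_cast
    field_simp
  rw [h1, h2, Complex.sub_re, Complex.ofReal_re, Complex.re_ofReal_mul] at h
  linarith

theorem exists_delta_bound {d n : ℕ} {Y : Fin d → H →L[ℂ] H} (hY : IsPositiveDecomposition Y)
    {Z : Fin d → Matrix (Fin n) (Fin n) ℂ} (hZ : Z ∈ polyUpperHalf d n) :
    ∃ ε : ℝ, 0 < ε ∧ ∀ x : Ampl H n, ε * ‖x‖ ^ 2 ≤ |(inner ℂ x (delta Y Z x)).im| := by
  choose r hr hM using fun i => exists_lower_bound (hZ i)
  obtain ⟨ε, hε, hle⟩ : ∃ ε : ℝ, 0 < ε ∧ ∀ i, ε ≤ r i := by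
    rcases isEmpty_or_nonempty (Fin d) with hd | hd
    · exact ⟨1, one_pos, fun i => hd.elim i⟩
    · exact ⟨Finset.univ.inf' Finset.univ_nonempty r, by simpa using hr,
        fun i => Finset.inf'_le _ (Finset.mem_univ i)⟩
  refine ⟨ε, hε, fun x => le_trans ?_ (le_abs_self _)⟩
  have h0 : ∀ i, 0 ≤ (∑ j, inner ℂ (x j) (Y i (x j))).re := fun i => by
    rw [Complex.re_sum]
    exact Finset.sum_nonneg fun j _ => (hY.isPositive i).re_inner_nonneg_right _
  have h1 : (inner ℂ x (delta Y Z x)).im = ∑ i, (inner ℂ x (kron (Y i) (Z i) x)).im := by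
    rw [delta, sum_apply, inner_sum, Complex.im_sum]
  have h2 : ‖x‖ ^ 2 = ∑ i, (∑ j, inner ℂ (x j) (Y i (x j))).re := by
    rw [← Complex.re_sum, Finset.sum_comm]
    simp only [← inner_sum, ← sum_apply, hY.sum_eq_one]
    rw [← inner_self_eq_norm_sq (𝕜 := ℂ) x, PiLp.inner_apply]
    rfl
  rw [h1, h2, Finset.mul_sum]
  exact Finset.sum_le_sum fun i _ =>
    (mul_le_mul_of_nonneg_right (hle i) (h0 i)).trans (im_inner_kron (hY.isPositive i) (hM i) x)

/-- `(A ⊗ I - δ_Y(Z))⁻¹` exists as an everywhere defined bounded operator. -/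
theorem type2Resolvent_spec [CompleteSpace H] {d n : ℕ} {A : H →ₗ.[ℂ] H} (hA : IsSelfAdjoint A)
    {Y : Fin d → H →L[ℂ] H} (hY : IsPositiveDecomposition Y)
    {Z : Fin d → Matrix (Fin n) (Fin n) ℂ} (hZ : Z ∈ polyUpperHalf d n) :
    (ampl A n - total (delta Y Z)).toFun.ker = ⊥ ∧
      resolventOp A Y Z = total (type2Resolvent A Y Z) := by
  obtain ⟨ε, hε, hB⟩ := exists_delta_bound hY hZ
  obtain ⟨hker, S, hS, -⟩ := exists_inverse (isSelfAdjoint_ampl hA n) (delta Y Z) hε hB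
  exact ⟨hker, toBounded_spec ⟨S, hS⟩⟩

theorem mem_graph_inverse {E : Type*} [NormedAddCommGroup E] [InnerProductSpace ℂ E]
    {T : E →ₗ.[ℂ] E} (hT : T.toFun.ker = ⊥) {x y : E} (h : (x, y) ∈ T.graph) :
    (y, x) ∈ T.inverse.graph := by
  obtain ⟨x', hx, hy⟩ := (LinearPMap.mem_graph_iff _).1 h
  simp only at hx hy
  subst hx hy
  exact LinearPMap.mem_inverse_graph hT x'

theorem mem_graph_oneSubI {A : H →ₗ.[ℂ] H} {x y : H} (h : (x, y) ∈ A.graph) :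
    (x, x - Complex.I • y) ∈ (oneSubI A).graph := by
  obtain ⟨x', hx, hy⟩ := (LinearPMap.mem_graph_iff _).1 h
  simp only at hx hy
  subst hx hy
  exact (LinearPMap.mem_graph_iff _).2 ⟨⟨x', Submodule.mem_top, x'.2⟩, rfl, rfl⟩

/-- `I - iA` is injective and `(I - iA)⁻¹` is an everywhere defined bounded operator. -/
theorem oneSubI_inverse_spec [CompleteSpace H] {A : H →ₗ.[ℂ] H} (hA : IsSelfAdjoint A) :
    (oneSubI A).toFun.ker = ⊥ ∧ ∃ R : H →L[ℂ] H, (oneSubI A).inverse = total R ∧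
      ∀ x, (R x, Complex.I • (x - R x)) ∈ A.graph := by
  obtain ⟨hker, S, -, hS⟩ := exists_inverse hA ((-Complex.I) • (1 : H →L[ℂ] H)) one_pos
    (fun x => by
      have : inner ℂ x (((-Complex.I) • (1 : H →L[ℂ] H)) x) =
          -Complex.I * ((‖x‖ ^ 2 : ℝ) : ℂ) := by
        rw [smul_apply, inner_smul_right, one_apply_eq_self,
          inner_self_eq_norm_sq_to_K]
        norm_cast
      rw [this, Complex.im_mul_ofReal]
      simp)
  have hkerI : (oneSubI A).toFun.ker = ⊥ := by
    rw [LinearMap.ker_eq_bot'] at hker ⊢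
    intro x hx
    have h : (x : H) - Complex.I • A ⟨x.1, x.2.2⟩ = 0 := hx
    have h' := hker ⟨x.1, x.2.2, Submodule.mem_top⟩ (by
      change A ⟨x.1, x.2.2⟩ - ((-Complex.I) • (x : H)) = 0
      have h2 := congrArg (fun z => Complex.I • z) h
      simp only [smul_sub, smul_smul, Complex.I_mul_I, smul_zero] at h2
      rw [← h2]
      module)
    exact Subtype.ext (congrArg (Subtype.val : (A - total _).domain → H) h')
  have hR : ∀ x, ((Complex.I • S) x, Complex.I • (x - (Complex.I • S) x)) ∈ A.graph := by
    intro x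
    have h := A.graph.smul_mem Complex.I (hS x)
    convert h using 1
    refine Prod.ext rfl ?_
    change Complex.I • (x - Complex.I • S x) = Complex.I • (x + (-Complex.I) • S x)
    rw [neg_smul, sub_eq_add_neg]
  refine ⟨hkerI, Complex.I • S, eq_total_iff fun x => mem_graph_inverse hkerI ?_, hR⟩
  have h := mem_graph_oneSubI (hR x)
  rw [smul_smul, Complex.I_mul_I] at h
  convert h using 2
  module

/-- The type 3 structured resolvent exists as an everywhere defined bounded operator. -/
theorem type3Resolvent_spec [CompleteSpace H] {d n : ℕ} {A : H →ₗ.[ℂ] H} (hA : IsSelfAdjoint A)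
    {Y : Fin d → H →L[ℂ] H} (hY : IsPositiveDecomposition Y)
    {Z : Fin d → Matrix (Fin n) (Fin n) ℂ} (hZ : Z ∈ polyUpperHalf d n) :
    resolventOp₃ A Y Z = total (type3Resolvent A Y Z) := by
  obtain ⟨ε, hε, hB⟩ := exists_delta_bound hY hZ
  obtain ⟨-, S, hS, hSg⟩ := exists_inverse (isSelfAdjoint_ampl hA n) (delta Y Z) hε hB
  obtain ⟨-, R, hR, hRg⟩ := oneSubI_inverse_spec hA
  let D := delta Y Z
  let R' : Ampl H n →L[ℂ] Ampl H n := kron R 1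
  have hR' : ∀ x j, R' x j = R (x j) := fun x j => by
    simp [R', kron_apply, Matrix.one_apply]
  let U : Ampl H n →L[ℂ] Ampl H n := R' + D ∘L (Complex.I • (1 - R'))
  refine toBounded_spec ⟨S ∘L U - Complex.I • (U + D ∘L S ∘L U), eq_total_iff fun x => ?_⟩
  have h1 : (x, R' x) ∈ (ampl (oneSubI A).inverse n).graph := by
    rw [mem_graph_ampl]
    intro j
    rw [hR', hR]
    exact mem_graph_total R (x j)
  have h2 : (R' x, Complex.I • (x - R' x)) ∈ (ampl A n).graph := by
    rw [mem_graph_ampl]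
    intro j
    have h := hRg (x j)
    rw [← hR'] at h
    exact h
  have h3 : (R' x, U x) ∈ (total 1 + mulOp (total (delta Y Z)) (ampl A n)).graph := by
    obtain ⟨z, hz, hz'⟩ := (LinearPMap.mem_graph_iff _).1
      (mem_graph_mulOp h2 (mem_graph_total (delta Y Z) _))
    simp only at hz hz'
    refine (LinearPMap.mem_graph_iff _).2 ⟨⟨R' x, Submodule.mem_top, hz ▸ z.2⟩, rfl, ?_⟩
    have h : mulOp (total (delta Y Z)) (ampl A n) ⟨R' x, hz ▸ z.2⟩ =
        delta Y Z (Complex.I • (x - R' x)) := by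
      rw [← hz']
      congr 1
      exact Subtype.ext hz.symm
    change R' x + mulOp (total (delta Y Z)) (ampl A n) ⟨R' x, hz ▸ z.2⟩ = U x
    rw [h]
    rfl
  have h4 : (U x, S (U x)) ∈ (resolventOp A Y Z).graph := by
    rw [resolventOp, hS]
    exact mem_graph_total S (U x)
  have h5 : (S (U x), S (U x) - Complex.I • (U x + D (S (U x)))) ∈
      (ampl (oneSubI A) n).graph := by
    rw [mem_graph_ampl]
    intro j
    exact mem_graph_oneSubI (mem_graph_ampl.1 (hSg (U x)) j)
  exact mem_graph_mulOp (mem_graph_mulOp (mem_graph_mulOp h1 h3) h4) h5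

/-! ### Nevanlinna representations -/

/-- The data `(a, A, Y, v)` on the Hilbert space `ℋ` form a type 2 Nevanlinna representation of
`h`: `h(Z) = a ⊗ I + (v* ⊗ I) M₂(Z) (v ⊗ I)` on `Πᵈ`. A self-adjoint `A` is automatically densely
defined and closed (`IsSelfAdjoint.dense_domain`, `IsSelfAdjoint.isClosed`). -/
structure IsType2Rep [CompleteSpace H] {d : ℕ} (h : GradedFun d) (a : ℝ) (A : H →ₗ.[ℂ] H)
    (Y : Fin d → H →L[ℂ] H) (v : H) : Prop where
  selfAdjoint : IsSelfAdjoint A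
  posDecomp : IsPositiveDecomposition Y
  eq : ∀ (n : ℕ), ∀ Z ∈ polyUpperHalf d n,
    Matrix.toEuclideanCLM (𝕜 := ℂ) (h n Z) =
      (a : ℂ) • 1 + (ket v n).adjoint ∘L type2Resolvent A Y Z ∘L ket v n

/-- The data `(a, A, Y, v)` on the Hilbert space `ℋ` form a type 3 Nevanlinna representation of
`h`: `h(Z) = a ⊗ I + (v* ⊗ I) M₃(Z) (v ⊗ I)` on `Πᵈ`. -/
structure IsType3Rep [CompleteSpace H] {d : ℕ} (h : GradedFun d) (a : ℝ) (A : H →ₗ.[ℂ] H)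
    (Y : Fin d → H →L[ℂ] H) (v : H) : Prop where
  selfAdjoint : IsSelfAdjoint A
  posDecomp : IsPositiveDecomposition Y
  eq : ∀ (n : ℕ), ∀ Z ∈ polyUpperHalf d n,
    Matrix.toEuclideanCLM (𝕜 := ℂ) (h n Z) =
      (a : ℂ) • 1 + (ket v n).adjoint ∘L type3Resolvent A Y Z ∘L ket v n

end Operators

/-- `h` has a type 2 Nevanlinna representation. -/
def HasType2Rep {d : ℕ} (h : GradedFun d) : Prop :=
  ∃ (H : Type u) (_ : NormedAddCommGroup H) (_ : InnerProductSpace ℂ H) (_ : CompleteSpace H)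
    (a : ℝ) (A : H →ₗ.[ℂ] H) (Y : Fin d → H →L[ℂ] H) (v : H), IsType2Rep h a A Y v

/-- `h` has a type 3 Nevanlinna representation. -/
def HasType3Rep {d : ℕ} (h : GradedFun d) : Prop :=
  ∃ (H : Type u) (_ : NormedAddCommGroup H) (_ : InnerProductSpace ℂ H) (_ : CompleteSpace H)
    (a : ℝ) (A : H →ₗ.[ℂ] H) (Y : Fin d → H →L[ℂ] H) (v : H), IsType3Rep h a A Y v

end

end FreePick

/-!
On `𝒟(A) ⊗ ℂⁿ` the two structured resolvents are related by the identity
`M₃(Z) = (1 - iA) M₂(Z) (1 + iA) - A`, which comes from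
`1 + δ_Y(Z) A = (1 + A²) - (A - δ_Y(Z)) A` and `1 + A² = (1 + iA) (1 - iA)`
(`type3Resolvent_apply_ket`). Compressing it to `w ⊗ ℂⁿ` with `w ∈ 𝒟(A)`, and moving `1 - iA` to the
other side of the inner product by self-adjointness, gives
`w* M₃(Z) w = ((1 + iA) w)* M₂(Z) ((1 + iA) w) - ⟪w, A w⟫`
(`ket_adjoint_type3Resolvent_ket`), where `⟪w, A w⟫` is a real constant. Hence `(a, A, Y, w)` is a
type 3 representation exactly when `(a - ⟪w, A w⟫, A, Y, (1 + iA) w)` is a type 2 representation.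
Since `1 + iA` maps `𝒟(A)` onto `ℋ`, this yields both directions.
-/

namespace FreePick

open scoped InnerProductSpace

variable {H : Type*} [NormedAddCommGroup H] [InnerProductSpace ℂ H]

theorem ket_apply (v : H) (n : ℕ) (c : EuclideanSpace ℂ (Fin n)) (j : Fin n) :
    ket v n c j = c j • v := rfl

theorem inner_ket_ket (v w : H) (n : ℕ) (e c : EuclideanSpace ℂ (Fin n)) :
    ⟪ket v n e, ket w n c⟫_ℂ = ⟪v, w⟫_ℂ * ⟪e, c⟫_ℂ := by
  simp only [PiLp.inner_apply, ket_apply, inner_smul_left, inner_smul_right, Finset.mul_sum,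
    RCLike.inner_apply]
  exact Finset.sum_congr rfl fun j _ => by ring

theorem ket_mem_graph_ampl {T : H →ₗ.[ℂ] H} {v w : H} (h : (v, w) ∈ T.graph) (n : ℕ)
    (c : EuclideanSpace ℂ (Fin n)) : (ket v n c, ket w n c) ∈ (ampl T n).graph :=
  mem_graph_ampl.2 fun j => T.graph.smul_mem (c j) h

theorem mem_graph_ampl_oneSubI {A : H →ₗ.[ℂ] H} {n : ℕ} {x y : Ampl H n}
    (h : (x, y) ∈ (ampl A n).graph) : (x, x - Complex.I • y) ∈ (ampl (oneSubI A) n).graph :=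
  mem_graph_ampl.2 fun j => mem_graph_oneSubI (mem_graph_ampl.1 h j)

section PartialOperators

variable {E : Type*} [NormedAddCommGroup E] [InnerProductSpace ℂ E]

theorem mem_graph_total_iff {M : E →L[ℂ] E} {x y : E} : (x, y) ∈ (total M).graph ↔ M x = y := by
  refine ⟨fun h => ?_, fun h => h ▸ mem_graph_total M x⟩
  obtain ⟨z, hz, hz'⟩ := (LinearPMap.mem_graph_iff _).1 h
  simp only at hz hz'
  rw [← hz', ← hz, total_apply]

theorem mem_graph_add {S T : E →ₗ.[ℂ] E} {x y z : E} (hy : (x, y) ∈ S.graph)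
    (hz : (x, z) ∈ T.graph) : (x, y + z) ∈ (S + T).graph := by
  obtain ⟨s, hs, rfl⟩ := (LinearPMap.mem_graph_iff _).1 hy
  obtain ⟨t, ht, rfl⟩ := (LinearPMap.mem_graph_iff _).1 hz
  simp only at hs ht
  subst hs
  refine (LinearPMap.mem_graph_iff _).2 ⟨⟨s, s.2, ht ▸ t.2⟩, rfl, ?_⟩
  rw [show T t = T ⟨s, ht ▸ t.2⟩ from congrArg T (Subtype.ext ht)]
  rfl

theorem mem_graph_sub {S T : E →ₗ.[ℂ] E} {x y z : E} (hy : (x, y) ∈ S.graph)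
    (hz : (x, z) ∈ T.graph) : (x, y - z) ∈ (S - T).graph := by
  obtain ⟨s, hs, rfl⟩ := (LinearPMap.mem_graph_iff _).1 hy
  obtain ⟨t, ht, rfl⟩ := (LinearPMap.mem_graph_iff _).1 hz
  simp only at hs ht
  subst hs
  refine (LinearPMap.mem_graph_iff _).2 ⟨⟨s, s.2, ht ▸ t.2⟩, rfl, ?_⟩
  rw [show T t = T ⟨s, ht ▸ t.2⟩ from congrArg T (Subtype.ext ht)]
  rfl

theorem inner_eq_of_mem_graph [CompleteSpace E] {T : E →ₗ.[ℂ] E} (hT : IsSelfAdjoint T)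
    {x y x' y' : E} (h : (x, y) ∈ T.graph) (h' : (x', y') ∈ T.graph) :
    ⟪y, x'⟫_ℂ = ⟪x, y'⟫_ℂ := by
  obtain ⟨s, rfl, rfl⟩ := (LinearPMap.mem_graph_iff _).1 h
  obtain ⟨t, rfl, rfl⟩ := (LinearPMap.mem_graph_iff _).1 h'
  have hf := LinearPMap.adjoint_isFormalAdjoint hT.dense_domain
  rw [LinearPMap.isSelfAdjoint_def.1 hT] at hf
  exact hf s t

theorem inner_mem_graph_eq_re [CompleteSpace E] {T : E →ₗ.[ℂ] E} (hT : IsSelfAdjoint T)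
    {x y : E} (h : (x, y) ∈ T.graph) : ⟪x, y⟫_ℂ = ((⟪x, y⟫_ℂ).re : ℂ) := by
  have h1 := inner_eq_of_mem_graph hT h h
  rw [← inner_conj_symm] at h1
  exact (Complex.conj_eq_iff_re.1 h1).symm

/-- `1 + iT` maps the domain of a self-adjoint `T` onto the whole space. -/
theorem exists_mem_graph_add_I_smul_eq [CompleteSpace E] {T : E →ₗ.[ℂ] E} (hT : IsSelfAdjoint T)
    (v : E) : ∃ w u, (w, u) ∈ T.graph ∧ w + Complex.I • u = v := by
  obtain ⟨-, S, -, hS⟩ := exists_inverse hT (Complex.I • (1 : E →L[ℂ] E)) one_pos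
    (fun x => by
      have : ⟪x, (Complex.I • (1 : E →L[ℂ] E)) x⟫_ℂ = Complex.I * ((‖x‖ ^ 2 : ℝ) : ℂ) := by
        rw [smul_apply, inner_smul_right, one_apply_eq_self,
          inner_self_eq_norm_sq_to_K]
        norm_cast
      rw [this, Complex.im_mul_ofReal]
      simp)
  -- `(1 + iT) w = v` is the resolvent equation `(T - i) w = -iv`.
  refine ⟨_, _, hS (-Complex.I • v), ?_⟩
  rw [smul_apply, one_apply_eq_self, smul_add, smul_smul,
    smul_smul, mul_neg, Complex.I_mul_I]
  module

end PartialOperators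

variable [CompleteSpace H] {d n : ℕ} {A : H →ₗ.[ℂ] H} {Y : Fin d → H →L[ℂ] H}
  {Z : Fin d → Matrix (Fin n) (Fin n) ℂ}

theorem type2Resolvent_apply_of_mem_graph (hA : IsSelfAdjoint A) (hY : IsPositiveDecomposition Y)
    (hZ : Z ∈ polyUpperHalf d n) {x y : Ampl H n} (h : (x, y) ∈ (ampl A n).graph) :
    type2Resolvent A Y Z (y - delta Y Z x) = x := by
  obtain ⟨hker, heq⟩ := type2Resolvent_spec hA hY hZ
  have h1 := mem_graph_inverse hker (mem_graph_sub h (mem_graph_total (delta Y Z) x))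
  change (_, x) ∈ (resolventOp A Y Z).graph at h1
  rwa [heq, mem_graph_total_iff] at h1

theorem mem_graph_type2Resolvent (hA : IsSelfAdjoint A) (hY : IsPositiveDecomposition Y)
    (hZ : Z ∈ polyUpperHalf d n) (q : Ampl H n) :
    (type2Resolvent A Y Z q, q + delta Y Z (type2Resolvent A Y Z q)) ∈ (ampl A n).graph := by
  obtain ⟨ε, hε, hB⟩ := exists_delta_bound hY hZ
  obtain ⟨-, S, -, hS⟩ := exists_inverse (isSelfAdjoint_ampl hA n) (delta Y Z) hε hB
  have h := type2Resolvent_apply_of_mem_graph hA hY hZ (hS q)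
  rw [add_sub_cancel_right] at h
  exact h ▸ hS q

/-- The identity `M₃(Z) = (1 - iA) M₂(Z) (1 + iA) - A` on `w ⊗ ℂⁿ`, where `A w = u` and
`A M₂(Z) q` is written as `q + δ_Y(Z) M₂(Z) q`. -/
theorem type3Resolvent_apply_ket (hA : IsSelfAdjoint A) (hY : IsPositiveDecomposition Y)
    (hZ : Z ∈ polyUpperHalf d n) {w u : H} (h : (w, u) ∈ A.graph)
    (c : EuclideanSpace ℂ (Fin n)) {q s : Ampl H n} (hq : q = ket (w + Complex.I • u) n c)
    (hs : s = type2Resolvent A Y Z q) :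
    type3Resolvent A Y Z (ket w n c) =
      (s - Complex.I • (q + delta Y Z s)) - ket u n c := by
  obtain ⟨-, R, hR, hRg⟩ := oneSubI_inverse_spec hA
  -- `p = (1 - iA)⁻¹ w`, `b = A p` and `A b = A² p`
  obtain ⟨p, hp⟩ : ∃ p, p = R w := ⟨_, rfl⟩
  obtain ⟨b, hb⟩ : ∃ b, b = Complex.I • (w - p) := ⟨_, rfl⟩
  have hpb : (p, b) ∈ A.graph := by rw [hb, hp]; exact hRg w
  have hb2 : (b, Complex.I • (u - b)) ∈ A.graph := by
    have := A.graph.smul_mem Complex.I (A.graph.sub_mem h hpb)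
    rw [hb] at this ⊢
    exact this
  have hwp : (w, p) ∈ (oneSubI A).inverse.graph := by
    rw [hR, mem_graph_total_iff, hp]
  have hsg := mem_graph_type2Resolvent hA hY hZ q
  rw [← hs] at hsg
  have hsub := (ampl A n).graph.sub_mem hsg (ket_mem_graph_ampl hb2 n c)
  change (s - ket b n c, (q + delta Y Z s) - ket (Complex.I • (u - b)) n c) ∈ _ at hsub
  have h1 := ket_mem_graph_ampl hwp n c
  have h2 : (ket p n c, ket p n c + delta Y Z (ket b n c)) ∈
      (total 1 + mulOp (total (delta Y Z)) (ampl A n)).graph :=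
    mem_graph_add (mem_graph_total 1 _)
      (mem_graph_mulOp (ket_mem_graph_ampl hpb n c) (mem_graph_total _ _))
  -- `(A - δ) (M₂ q - A p) = p + δ A p`, because `q - A² p = p`
  have h3 : (ket p n c + delta Y Z (ket b n c), s - ket b n c) ∈ (resolventOp A Y Z).graph := by
    rw [(type2Resolvent_spec hA hY hZ).2, mem_graph_total_iff]
    rw [← type2Resolvent_apply_of_mem_graph hA hY hZ hsub]
    congr 1
    have hqp : q - ket (Complex.I • (u - b)) n c = ket p n c := by
      ext j
      rw [hq, hb, PiLp.sub_apply, ket_apply, ket_apply, ket_apply, smul_sub, smul_smul,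
        Complex.I_mul_I]
      module
    rw [← hqp, map_sub]
    abel
  have h4 := mem_graph_mulOp (mem_graph_mulOp (mem_graph_mulOp h1 h2) h3)
    (mem_graph_ampl_oneSubI hsub)
  change (_, _) ∈ (resolventOp₃ A Y Z).graph at h4
  rw [type3Resolvent_spec hA hY hZ, mem_graph_total_iff] at h4
  rw [h4]
  ext j
  simp only [PiLp.sub_apply, PiLp.smul_apply, PiLp.add_apply, ket_apply, smul_sub, smul_add,
    smul_comm (c j) Complex.I, smul_smul Complex.I Complex.I, Complex.I_mul_I]
  module

/-- `w* M₃(Z) w = ((1 + iA) w)* M₂(Z) ((1 + iA) w) - ⟪w, A w⟫` for `w` in the domain of `A`, where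
`A w = u`. -/
theorem ket_adjoint_type3Resolvent_ket (hA : IsSelfAdjoint A) (hY : IsPositiveDecomposition Y)
    (hZ : Z ∈ polyUpperHalf d n) {w u : H} (h : (w, u) ∈ A.graph) :
    (ket w n).adjoint ∘L type3Resolvent A Y Z ∘L ket w n =
      (ket (w + Complex.I • u) n).adjoint ∘L type2Resolvent A Y Z ∘L
        ket (w + Complex.I • u) n - ((⟪w, u⟫_ℂ).re : ℂ) • 1 := by
  refine ContinuousLinearMap.ext fun c => ext_inner_left ℂ fun e => ?_
  obtain ⟨q, hq⟩ : ∃ q, q = ket (w + Complex.I • u) n c := ⟨_, rfl⟩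
  obtain ⟨s, hs⟩ : ∃ s, s = type2Resolvent A Y Z q := ⟨_, rfl⟩
  have hsg := mem_graph_type2Resolvent hA hY hZ q
  rw [← hs] at hsg
  have hsym := inner_eq_of_mem_graph (isSelfAdjoint_ampl hA n) (ket_mem_graph_ampl h n e) hsg
  have hket : ket (w + Complex.I • u) n e = ket w n e + Complex.I • ket u n e := by
    ext j
    simp only [PiLp.add_apply, PiLp.smul_apply, ket_apply, smul_add, smul_comm (e j) Complex.I]
  simp only [ContinuousLinearMap.comp_apply, sub_apply,
    smul_apply, one_apply_eq_self, inner_sub_right,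
    ContinuousLinearMap.adjoint_inner_right, inner_smul_right]
  rw [type3Resolvent_apply_ket hA hY hZ h c hq hs, ← inner_mem_graph_eq_re hA h, ← hq, ← hs,
    inner_sub_right, inner_ket_ket, inner_sub_right, inner_smul_right, ← hsym, hket,
    inner_add_left, inner_smul_left, Complex.conj_I]
  ring

/-- For `w` in the domain of `A`, with `A w = u`, type 3 representations with vector `w` correspond
to type 2 representations with vector `(1 + iA) w`. -/
theorem isType3Rep_iff_isType2Rep {h : GradedFun d} {a : ℝ} {w u : H} (hwu : (w, u) ∈ A.graph) :
    IsType3Rep h a A Y w ↔ IsType2Rep h (a - (⟪w, u⟫_ℂ).re) A Y (w + Complex.I • u) := by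
  constructor
  all_goals
    rintro ⟨hA, hY, heq⟩
    refine ⟨hA, hY, fun n Z hZ => ?_⟩
    rw [heq n Z hZ, ket_adjoint_type3Resolvent_ket hA hY hZ hwu, Complex.ofReal_sub]
    module

end FreePick

theorem mainTheorem4 {d : ℕ} (h : FreePick.GradedFun d) (hh : FreePick.IsFreePick h) :
    (FreePick.HasType2Rep.{u} h → FreePick.HasType3Rep.{u} h) ∧
    ((∃ (H : Type u) (_ : NormedAddCommGroup H) (_ : InnerProductSpace ℂ H) (_ : CompleteSpace H)
        (a : ℝ) (A : H →ₗ.[ℂ] H) (Y : Fin d → H →L[ℂ] H) (v : H),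
        FreePick.IsType3Rep h a A Y v ∧ v ∈ A.domain) →
      FreePick.HasType2Rep.{u} h) := by
  refine ⟨?_, ?_⟩
  · rintro ⟨H, _, _, _, a, A, Y, v, hrep⟩
    obtain ⟨w, u, hwu, rfl⟩ := FreePick.exists_mem_graph_add_I_smul_eq hrep.selfAdjoint v
    refine ⟨H, _, _, ‹_›, a + (inner ℂ w u).re, A, Y, w,
      (FreePick.isType3Rep_iff_isType2Rep hwu).2 ?_⟩
    rwa [add_sub_cancel_right]
  · rintro ⟨H, _, _, _, a, A, Y, v, hrep, hv⟩
    exact ⟨H, _, _, ‹_›, _, A, Y, _,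
      (FreePick.isType3Rep_iff_isType2Rep (A.mem_graph ⟨v, hv⟩)).1 hrep⟩
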